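/- For each $n\in\mathbb N=\{1,2,\dots\}$, coupons arrive one by one at times $1,2,\dots$; their types are independent and uniformly distributed on a set of $n$ types. There are collectors labelled $r=0,1,2,\dots$, all starting with empty albums; each arriving coupon is placed in the album of the collector with the smallest label whose album does not yet contain a coupon of that type. Let $T_r^{(n)}$ be the time at which collector $r$ completes his album, i.e. first has all $n$ types; almost surely $T_r^{(n)}<\infty$ for all $r\in\mathbb N_0$. Let $B_r$, $r\in\mathbb N_0$, be independent random variables with $$\mathbb P\{B_r<x\}=\exp\Bigl(-\frac{e^{-x}}{r!}\Bigr),\qquad x\in\mathbb R.$$ Then $$\Bigl(\frac{T_r^{(n)}}{n}-\ln n-r\ln\ln n,\ r\in\mathbb N_0\Bigr)\xrightarrow{d}(B_r,\ r\in\mathbb N_0)\quad\text{in }\mathbb R^\infty\text{ as }n\to\infty,$$ where $\mathbb R^\infty=\mathbb R^{\mathbb N_0}$ carries the product topology. -/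

import Mathlib

open MeasureTheory ProbabilityTheory Filter
open scoped Nat

namespace CouponCollector

/-- `album x k r` is the set of coupon types present in the album of collector `r`
(`0` is the main collector, `1, 2, …` are the younger brothers) after the first `k` coupons
`x 0, …, x (k - 1)` have arrived. All albums are empty at time `0`. The coupon arriving at time
`k + 1` is of type `x k`; it is put into the album of the first collector, in the order
`0, 1, 2, …`, who does not yet have this type, and no other album changes. -/
def album {n : ℕ} (x : ℕ → Fin n) : ℕ → ℕ → Set (Fin n)
  | 0, _ => ∅
  | k + 1, r =>
      album x k r ∪ {i | i = x k ∧ i ∉ album x k r ∧ ∀ s, s < r → i ∈ album x k s}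

/-- The time at which collector `r` completes his album: the least `k` such that all `n` types
are in his album after `k` arrivals. The value is the junk value `0` if the album is never
completed. -/
noncomputable def completionTime {n : ℕ} (x : ℕ → Fin n) (r : ℕ) : ℕ :=
  sInf {k : ℕ | album x k r = Set.univ}

/-- The sequence of the centred and normalised completion times of all collectors,
`T_r / n - ln n - r ln ln n` for `r = 0, 1, 2, …`, as a point of `ℕ → ℝ`. -/
noncomputable def normalizedTimes {n : ℕ} (x : ℕ → Fin n) : ℕ → ℝ := fun r =>
  (completionTime x r : ℝ) / (n : ℝ) - Real.log (n : ℝ)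
    - (r : ℝ) * Real.log (Real.log (n : ℝ))

end CouponCollector

open scoped Topology NNReal ENNReal

/-!
If the arrival process is run for Poisson times, the number of coupons of each of the `n` types
becomes a Poisson count, independently over the types. Collector `r` is done once every type has
been seen more than `r` times; at time `n (ln n + r ln ln n + x)` a given type fails this with
probability `exp (-x) / (r! n)`, up to a factor tending to one. The critical times of different
collectors differ by at least about `n ln ln n`, in which time a given type gains arbitrarily many
coupons, so the failures of one type for different collectors are asymptotically disjoint, their
probabilities add up, and the `n`-th power turns the sum into a product of Gumbel distribution
functions. Chebyshev's inequality replaces the Poisson times by deterministic ones, at the price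
of shifting `x` by `1 / ln n`.
-/

namespace CouponCollector

section WeakConvergence

variable {κ ι : Type*} {l : Filter ι}

lemma measurableSet_forall_mem_le (S : Finset κ) (b : κ → ℝ) :
    MeasurableSet {y : κ → ℝ | ∀ r ∈ S, y r ≤ b r} := by
  simp only [Set.ofPred_forall]
  exact S.measurableSet_biInter fun r _ => measurableSet_le (measurable_pi_apply r) measurable_const

lemma forall_mem_le_update_min_iff {β : Type*} [DecidableEq κ] [LinearOrder β] {S : Finset κ}
    {q : κ} (hq : q ∈ S) {b y : κ → β} {c : β} :
    (∀ r ∈ S, y r ≤ Function.update b q (min c (b q)) r) ↔ (∀ r ∈ S, y r ≤ b r) ∧ y q ≤ c := by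
  have hle : Function.update b q (min c (b q)) ≤ b := update_le_self_iff.2 (min_le_right _ _)
  refine ⟨fun h => ⟨fun r hr => (h r hr).trans (hle r), ?_⟩, fun h r hr => ?_⟩
  · simpa using (h q hq).trans (by simp)
  · rcases eq_or_ne r q with rfl | hrq
    · simpa using ⟨h.2, h.1 r hr⟩
    · simpa [hrq] using h.1 r hr

lemma tendsto_measureReal_pi_Ioc {μ : ι → Measure (κ → ℝ)} [∀ i, IsFiniteMeasure (μ i)]
    {ν : Measure (κ → ℝ)} [IsFiniteMeasure ν] (S : Finset κ)
    (h : ∀ b : κ → ℝ, Tendsto (fun i => (μ i).real {y | ∀ r ∈ S, y r ≤ b r}) l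
      (𝓝 (ν.real {y | ∀ r ∈ S, y r ≤ b r}))) (a b : κ → ℝ) :
    Tendsto (fun i => (μ i).real ((S : Set κ).pi fun r => Set.Ioc (a r) (b r))) l
      (𝓝 (ν.real ((S : Set κ).pi fun r => Set.Ioc (a r) (b r)))) := by
  classical
  let box (R : Finset κ) (b : κ → ℝ) : Set (κ → ℝ) :=
    {y | (∀ r ∈ S, y r ≤ b r) ∧ ∀ r ∈ R, a r < y r}
  suffices hbox : ∀ R ⊆ S, ∀ b, Tendsto (fun i => (μ i).real (box R b)) l
      (𝓝 (ν.real (box R b))) by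
    have hpi : (S : Set κ).pi (fun r => Set.Ioc (a r) (b r)) = box S b := by
      ext y
      simp only [box, Set.mem_pi, Finset.mem_coe, Set.mem_Ioc, Set.mem_ofPred_eq, forall_and,
        and_comm]
    rw [hpi]
    exact hbox S subset_rfl b
  intro R
  induction R using Finset.induction_on with
  | empty => simpa [box] using h
  | insert q R _ ih =>
    intro hR b
    obtain ⟨hqS, hRS⟩ := Finset.insert_subset_iff.1 hR
    let b' := Function.update b q (min (a q) (b q))
    have hsplit : ∀ (m : Measure (κ → ℝ)) [IsFiniteMeasure m],
        m.real (box (insert q R) b) = m.real (box R b) - m.real (box R b') := fun m _ => by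
      have hdiff : box (insert q R) b = box R b \ {y | y q ≤ a q} := by
        ext y
        simp only [box, Finset.forall_mem_insert, Set.mem_ofPred_eq, Set.mem_sdiff, not_le]
        tauto
      have hinter : box R b' = box R b ∩ {y | y q ≤ a q} := by
        ext y
        simp only [box, b', Set.mem_ofPred_eq, Set.mem_inter_iff, forall_mem_le_update_min_iff hqS,
          and_right_comm]
      rw [hdiff, hinter, ← measureReal_sdiff_add_inter (s := box R b)
        (measurableSet_le (measurable_pi_apply q) measurable_const), add_sub_cancel_right]
    simp_rw [hsplit]
    exact (ih hRS b).sub (ih hRS b')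

lemma exists_pi_Ioc_mem_nhds_subset {u : Set (κ → ℝ)} (hu : IsOpen u) {x : κ → ℝ} (hx : x ∈ u) :
    ∃ (S : Finset κ) (a b : κ → ℝ), (∀ r, a r < b r) ∧
      (S : Set κ).pi (fun r => Set.Ioc (a r) (b r)) ∈ 𝓝 x ∧
      (S : Set κ).pi (fun r => Set.Ioc (a r) (b r)) ⊆ u := by
  obtain ⟨S, t, ht, hsub⟩ := isOpen_pi_iff.1 hu x hx
  have hIoc : ∀ r, ∃ a b, x r ∈ Set.Ioo a b ∧ (r ∈ S → Set.Ioc a b ⊆ t r) := fun r => by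
    by_cases hr : r ∈ S
    · obtain ⟨ε, hε, hball⟩ := Metric.nhds_basis_closedBall.mem_iff.1
        ((ht r hr).1.mem_nhds (ht r hr).2)
      rw [Real.closedBall_eq_Icc] at hball
      exact ⟨x r - ε, x r + ε, ⟨by linarith, by linarith⟩,
        fun _ => Set.Ioc_subset_Icc_self.trans hball⟩
    · exact ⟨x r - 1, x r + 1, ⟨by linarith, by linarith⟩, fun h => absurd h hr⟩
  choose a b hx hab using hIoc
  exact ⟨S, a, b, fun r => (hx r).1.trans (hx r).2,
    set_pi_mem_nhds S.finite_toSet fun r _ => Ioc_mem_nhds (hx r).1 (hx r).2,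
    (Set.pi_mono fun r hr => hab r hr).trans hsub⟩

theorem tendsto_probabilityMeasure_of_tendsto_cdf [Countable κ] [l.IsCountablyGenerated]
    {μ : ι → ProbabilityMeasure (κ → ℝ)} {ν : ProbabilityMeasure (κ → ℝ)}
    (h : ∀ (S : Finset κ) (b : κ → ℝ),
      Tendsto (fun i => (μ i : Measure (κ → ℝ)).real {y | ∀ r ∈ S, y r ≤ b r}) l
        (𝓝 ((ν : Measure (κ → ℝ)).real {y | ∀ r ∈ S, y r ≤ b r}))) :
    Tendsto μ l (𝓝 ν) := by
  classical
  -- `univ` is adjoined so that intersections of cylinders over different coordinates stay inside.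
  let C : κ → Set (Set ℝ) := fun _ => insert Set.univ {s | ∃ a b, a < b ∧ Set.Ioc a b = s}
  have hC : ∀ {S : Finset κ} {t : κ → Set ℝ}, t ∈ Set.univ.pi C →
      ∃ (R : Finset κ) (a b : κ → ℝ),
        (S : Set κ).pi t = (R : Set κ).pi fun r => Set.Ioc (a r) (b r) := by
    intro S t ht
    have hIoc : ∀ r, ∃ a b, t r ≠ Set.univ → t r = Set.Ioc a b := fun r => by
      rcases ht r (Set.mem_univ r) with hr | ⟨a, b, -, hr⟩
      · exact ⟨0, 0, fun h => absurd hr h⟩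
      · exact ⟨a, b, fun _ => hr.symm⟩
    choose a b hab using hIoc
    refine ⟨S.filter fun r => t r ≠ Set.univ, a, b, ?_⟩
    ext y
    simp only [Set.mem_pi, Finset.mem_coe, Finset.mem_filter]
    refine ⟨fun h r hr => hab r hr.2 ▸ h r hr.1, fun h r hr => ?_⟩
    by_cases htr : t r = Set.univ
    · simp [htr]
    · exact hab r htr ▸ h r ⟨hr, htr⟩
  refine (isPiSystem_squareCylinders (C := C)
    (fun _ => (isPiSystem_Ioc id id).insert_univ) fun _ => Set.mem_insert _ _)
    |>.tendsto_probabilityMeasure_of_tendsto_of_mem ?_ ?_ ?_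
  · rintro _ ⟨S, t, ht, rfl⟩
    obtain ⟨R, a, b, hR⟩ := hC (S := S) ht
    rw [hR]
    exact .pi R.countable_toSet fun r _ => measurableSet_Ioc
  · intro u hu x hx
    obtain ⟨S, a, b, hlt, hmem, hsub⟩ := exists_pi_Ioc_mem_nhds_subset hu hx
    exact ⟨_, ⟨S, _, fun r _ => Or.inr ⟨a r, b r, hlt r, rfl⟩, rfl⟩, hmem, hsub⟩
  · rintro _ ⟨S, t, ht, rfl⟩
    obtain ⟨R, a, b, hR⟩ := hC (S := S) ht
    rw [hR, ← NNReal.tendsto_coe]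
    exact tendsto_measureReal_pi_Ioc R (h R) a b

end WeakConvergence

section Counting

variable {ι α : Type*} [DecidableEq α]

/-- The number of coupons of type `a` among the coupons `x j`, `j ∈ J`. Arbitrary finite sets `J`
of arrivals are allowed, since the proof cuts the coupon stream into consecutive blocks. -/
def typeCount (x : ι → α) (J : Finset ι) (a : α) : ℕ := (J.filter fun j => x j = a).card

lemma typeCount_empty (x : ι → α) : typeCount x ∅ = 0 := rfl

lemma typeCount_insert [DecidableEq ι] (x : ι → α) {J : Finset ι} {j : ι} (hj : j ∉ J) :
    typeCount x (insert j J) = typeCount x J + Pi.single (x j) 1 := by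
  ext a
  rcases eq_or_ne (x j) a with rfl | ha
  · simp [typeCount, Finset.filter_insert, hj]
  · simp [typeCount, Finset.filter_insert, ha]

lemma typeCount_range_succ (x : ℕ → α) (k : ℕ) :
    typeCount x (Finset.range (k + 1)) = typeCount x (Finset.range k) + Pi.single (x k) 1 := by
  rw [Finset.range_add_one, typeCount_insert x Finset.notMem_range_self]

lemma typeCount_mono (x : ι → α) : Monotone (typeCount x) := fun _ _ h _ =>
  Finset.card_le_card (Finset.filter_subset_filter _ h)

lemma typeCount_biUnion {κ : Type*} [DecidableEq ι] (x : ι → α) {S : Finset κ} {J : κ → Finset ι}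
    (hJ : (S : Set κ).PairwiseDisjoint J) (a : α) :
    typeCount x (S.biUnion J) a = ∑ s ∈ S, typeCount x (J s) a := by
  rw [typeCount, Finset.filter_biUnion, Finset.card_biUnion]
  · rfl
  · exact fun s hs t ht hst => Finset.disjoint_filter_filter (hJ hs ht hst)

lemma sum_typeCount [Fintype α] (x : ι → α) (J : Finset ι) : ∑ a, typeCount x J a = J.card :=
  (Finset.card_eq_sum_card_fiberwise fun j _ => Finset.mem_univ (x j)).symm

lemma typeCount_range_nth (x : ℕ → α) {a : α} (h : ∃ᶠ k in atTop, x k = a) (r : ℕ) :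
    typeCount x (Finset.range (Nat.nth (fun k => x k = a) r)) a = r := by
  rw [typeCount, ← Nat.count_eq_card_filter_range,
    Nat.count_nth_of_infinite (Nat.frequently_atTop_iff_infinite.1 h)]

end Counting

section Albums

variable {n : ℕ}

lemma mem_album_iff (x : ℕ → Fin n) (k r : ℕ) (i : Fin n) :
    i ∈ album x k r ↔ r < typeCount x (Finset.range k) i := by
  induction k generalizing r with
  | zero => simp [album, typeCount]
  | succ k ih =>
    simp only [album, Set.mem_union, Set.mem_ofPred_eq, ih, typeCount_range_succ, Pi.add_apply,
      Pi.single_apply]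
    -- Collector `r` gets the coupon exactly when the current count of its type equals `r`.
    have hall : (∀ s < r, s < typeCount x (Finset.range k) i) ↔
        r ≤ typeCount x (Finset.range k) i :=
      ⟨fun h => not_lt.1 fun hlt => lt_irrefl _ (h _ hlt), fun h s hs => hs.trans_le h⟩
    rw [hall]
    split_ifs with hi
    · simp only [hi, true_and, not_lt]
      omega
    · simp [hi]

lemma album_eq_univ_iff (x : ℕ → Fin n) (k r : ℕ) :
    album x k r = Set.univ ↔ ∀ i, r < typeCount x (Finset.range k) i := by
  simp only [Set.eq_univ_iff_forall, mem_album_iff]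

lemma album_mono (x : ℕ → Fin n) (r : ℕ) : Monotone fun k => album x k r := fun k m hkm i hi => by
  rw [mem_album_iff] at hi ⊢
  exact hi.trans_le (typeCount_mono x (Finset.range_mono hkm) i)

lemma completionTime_le_iff {x : ℕ → Fin n} {r : ℕ} (h : ∃ k, album x k r = Set.univ) (k : ℕ) :
    completionTime x r ≤ k ↔ album x k r = Set.univ := by
  refine ⟨fun hk => ?_, fun hk => Nat.sInf_le hk⟩
  have hmem : album x (completionTime x r) r = Set.univ := Nat.sInf_mem h
  exact Set.univ_subset_iff.1 (hmem ▸ album_mono x r hk)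

lemma exists_album_eq_univ {x : ℕ → Fin n} (h : ∀ i, ∃ᶠ k in atTop, x k = i) (r : ℕ) :
    ∃ k, album x k r = Set.univ := by
  refine ⟨Finset.univ.sup fun i => Nat.nth (fun k => x k = i) (r + 1),
    Set.eq_univ_of_forall fun i => album_mono x r (Finset.le_sup (Finset.mem_univ i)) ?_⟩
  rw [mem_album_iff, typeCount_range_nth x (h i)]
  exact r.lt_succ_self

end Albums

section Measurability

variable {Ω : Type*} [MeasurableSpace Ω]

lemma measurable_typeCount {ι α : Type*} [DecidableEq α] [MeasurableSpace α]
    [MeasurableSingletonClass α] {X : ι → Ω → α} {J : Finset ι} (hX : ∀ j ∈ J, Measurable (X j)) :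
    Measurable fun ω => typeCount (X · ω) J := by
  refine measurable_pi_lambda _ fun a => ?_
  simp only [typeCount, Finset.card_filter]
  exact Finset.measurable_sum _ fun j hj => Measurable.ite
    (hX j hj (measurableSet_singleton a)) measurable_const measurable_const

lemma measurable_sInf_nat {s : ℕ → Set Ω} (hs : ∀ k, MeasurableSet (s k)) :
    Measurable fun ω => sInf {k | ω ∈ s k} := by
  refine measurable_of_Iic fun k => ?_
  have : (fun ω => sInf {k | ω ∈ s k}) ⁻¹' Set.Iic k = (⋃ m ∈ Set.Iic k, s m) ∪ ⋂ m, (s m)ᶜ := by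
    ext ω
    simp only [Set.mem_preimage, Set.mem_Iic, Set.mem_union, Set.mem_iUnion, Set.mem_iInter,
      Set.mem_compl_iff, exists_prop]
    rcases Set.eq_empty_or_nonempty {k | ω ∈ s k} with h | h
    · simp only [h, Nat.sInf_empty, zero_le, true_iff]
      exact Or.inr fun m hm => Set.eq_empty_iff_forall_notMem.1 h m hm
    · refine ⟨fun hk => Or.inl ⟨_, hk, Nat.sInf_mem h⟩, ?_⟩
      rintro (⟨m, hm, hω⟩ | hω)
      · exact (Nat.sInf_le hω).trans hm
      · exact absurd (Nat.sInf_mem h) (hω _)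
  rw [this]
  exact (MeasurableSet.biUnion (Set.to_countable _) fun m _ => hs m).union
    (MeasurableSet.iInter fun m => (hs m).compl)

variable {n : ℕ} {X : ℕ → Ω → Fin n}

lemma measurable_completionTime (hX : ∀ k, Measurable (X k)) (r : ℕ) :
    Measurable fun ω => completionTime (X · ω) r := by
  refine measurable_sInf_nat (s := fun k => {ω | album (X · ω) k r = Set.univ}) fun k => ?_
  simp only [album_eq_univ_iff, Set.ofPred_forall]
  exact MeasurableSet.iInter fun i => measurableSet_lt measurable_const
    ((measurable_pi_apply i).comp (measurable_typeCount fun j _ => hX j))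

lemma measurable_normalizedTimes (hX : ∀ k, Measurable (X k)) :
    Measurable fun ω => normalizedTimes (X · ω) :=
  measurable_pi_lambda _ fun r =>
    (((measurable_from_top (f := Nat.cast (R := ℝ))).comp
      (measurable_completionTime hX r)).div_const _).sub_const _ |>.sub_const _

end Measurability

section Completion

variable {Ω : Type*} [MeasurableSpace Ω] {μ : Measure Ω}

lemma ae_frequently_mem_of_iIndepFun {α : Type*} [MeasurableSpace α] {X : ℕ → Ω → α}
    (hX : ∀ k, Measurable (X k)) (hindep : iIndepFun X μ) {s : Set α} (hs : MeasurableSet s)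
    (hdiv : ∑' k, μ (X k ⁻¹' s) = ∞) : ∀ᵐ ω ∂μ, ∃ᶠ k in atTop, X k ω ∈ s := by
  have := hindep.isProbabilityMeasure
  have hmeas : ∀ k, MeasurableSet (X k ⁻¹' s) := fun k => hX k hs
  have hset : iIndepSet (fun k => X k ⁻¹' s) μ := (iIndepSet_iff_meas_biInter hmeas).2
    fun T => hindep.measure_inter_preimage_eq_mul T fun _ _ => hs
  filter_upwards [(mem_ae_iff_prob_eq_one (MeasurableSet.measurableSet_limsup hmeas)).2
    (measure_limsup_eq_one hmeas hset hdiv)] with ω hω using mem_limsup_iff_frequently_mem.1 hω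

variable {n : ℕ} {X : ℕ → Ω → Fin n}

lemma ae_exists_album_eq_univ (hX : ∀ k, Measurable (X k)) (hindep : iIndepFun X μ)
    (hunif : ∀ k i, μ.real {ω | X k ω = i} = 1 / (n : ℝ)) :
    ∀ᵐ ω ∂μ, ∀ r : ℕ, ∃ k : ℕ, album (X · ω) k r = Set.univ := by
  have := hindep.isProbabilityMeasure
  have hfreq : ∀ i, ∀ᵐ ω ∂μ, ∃ᶠ k in atTop, X k ω = i := fun i => by
    refine ae_frequently_mem_of_iIndepFun hX hindep (measurableSet_singleton i) ?_
    have hprob : ∀ k, μ (X k ⁻¹' {i}) = ENNReal.ofReal (1 / n) := fun k => by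
      rw [← hunif k i, ofReal_measureReal]
      rfl
    simp_rw [hprob]
    exact ENNReal.tsum_const_eq_top_of_ne_zero (by simpa using i.pos.ne')
  filter_upwards [ae_all_iff.2 hfreq] with ω hω using exists_album_eq_univ hω

end Completion

section MultinomialWeight

variable {α : Type*} [Fintype α]

/-- The weight of the count vector `y` in the generating function of the multinomial laws with
parameters `p`; the multinomial probabilities are these weights times a factorial. -/
noncomputable def multinomialWeight (p : α → ℝ) (y : α → ℕ) : ℝ :=
  ∏ a, p a ^ y a / (y a)!

lemma multinomialWeight_add_single [DecidableEq α] (p : α → ℝ) (y : α → ℕ) (a : α) :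
    (y a + 1) * multinomialWeight p (y + Pi.single a 1) = p a * multinomialWeight p y := by
  rw [multinomialWeight, multinomialWeight, ← Finset.mul_prod_erase _ _ (Finset.mem_univ a),
    ← Finset.mul_prod_erase _ (fun b => p b ^ y b / (y b)!) (Finset.mem_univ a), ← mul_assoc,
    ← mul_assoc]
  congr 1
  · rw [Pi.add_apply, Pi.single_eq_same, pow_succ, Nat.factorial_succ]
    push_cast
    field_simp
  · exact Finset.prod_congr rfl fun b hb => by simp [Finset.ne_of_mem_erase hb]

end MultinomialWeight

section Multinomial

variable {Ω ι κ α : Type*}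

lemma iIndep_biSup_of_pairwise_disjoint {mΩ : MeasurableSpace Ω} {μ : Measure Ω}
    {m : ι → MeasurableSpace Ω} (hm : ∀ i, m i ≤ mΩ) (h : iIndep m μ) {J : κ → Set ι}
    (hJ : Pairwise (Function.onFun Disjoint J)) : iIndep (fun s => ⨆ i ∈ J s, m i) μ := by
  classical
  have := h.isProbabilityMeasure
  rw [iIndep_iff]
  intro S
  induction S using Finset.induction_on with
  | empty => simp
  | insert q S hq ih =>
    intro f hf
    have hfS : ∀ s ∈ S, MeasurableSet[⨆ i ∈ J s, m i] (f s) :=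
      fun s hs => hf s (Finset.mem_insert_of_mem hs)
    have hind : Indep (⨆ i ∈ J q, m i) (⨆ i ∈ ⋃ s ∈ S, J s, m i) μ :=
      indep_iSup_of_disjoint hm h <| Set.disjoint_iUnion₂_right.2 fun s hs =>
        hJ (ne_of_mem_of_not_mem hs hq).symm
    have hle : ∀ s ∈ S, (⨆ i ∈ J s, m i) ≤ ⨆ i ∈ ⋃ s ∈ S, J s, m i := fun s hs =>
      biSup_mono fun i hi => Set.mem_biUnion hs hi
    have hmeas : MeasurableSet[⨆ i ∈ ⋃ s ∈ S, J s, m i] (⋂ s ∈ S, f s) :=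
      @Finset.measurableSet_biInter _ _ (_) _ S fun s hs => hle s hs _ (hfS s hs)
    rw [Finset.set_biInter_insert, Finset.prod_insert hq, ← ih hfS]
    exact (Indep_iff _ _ μ).1 hind _ _ (hf q (Finset.mem_insert_self q S)) hmeas

variable [DecidableEq α] [MeasurableSpace α] [MeasurableSingletonClass α] {X : ι → Ω → α}

lemma measurable_typeCount_biSup_comap (J : Finset ι) :
    Measurable[⨆ j ∈ J, MeasurableSpace.comap (X j) inferInstance]
      fun ω => typeCount (X · ω) J := by
  let _ : MeasurableSpace Ω := ⨆ j ∈ J, MeasurableSpace.comap (X j) inferInstance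
  exact measurable_typeCount fun j hj =>
    (comap_measurable (X j)).mono (le_biSup (fun j => MeasurableSpace.comap (X j) _) hj) le_rfl

variable [MeasurableSpace Ω] {μ : Measure Ω}

lemma iIndepFun_typeCount (hX : ∀ j, Measurable (X j)) (hindep : iIndepFun X μ)
    {J : κ → Finset ι} (hJ : Pairwise (Function.onFun Disjoint J)) :
    iIndepFun (fun s ω => typeCount (X · ω) (J s)) μ := by
  refine (iIndepFun_iff_iIndep _ _ μ).2 <| iIndep_of_iIndep_of_le
    (iIndep_biSup_of_pairwise_disjoint (fun j => (hX j).comap_le) hindep (J := fun s => ↑(J s))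
      fun s t hst => Finset.disjoint_coe.2 (hJ hst)) fun s => ?_
  exact (measurable_typeCount_biSup_comap (J s)).comap_le

lemma indepFun_typeCount (hX : ∀ j, Measurable (X j)) (hindep : iIndepFun X μ) {J : Finset ι}
    {j : ι} (hj : j ∉ J) : IndepFun (X j) (fun ω => typeCount (X · ω) J) μ := by
  have h := indep_iSup_of_disjoint (fun j => (hX j).comap_le) hindep
    (Set.disjoint_singleton_left.2 (Finset.mem_coe.not.2 hj))
  rw [iSup_singleton] at h
  exact indep_of_indep_of_le_right h (measurable_typeCount_biSup_comap J).comap_le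

lemma measureReal_inter_typeCount_add_single_eq [Fintype α] (hX : ∀ j, Measurable (X j))
    (hindep : iIndepFun X μ) {p : α → ℝ} {J : Finset ι} {j : ι} (hj : j ∉ J) {a : α}
    (hp : μ.real (X j ⁻¹' {a}) = p a)
    (hJ : ∀ z : α → ℕ, ∑ b, z b = J.card →
      μ.real {ω | typeCount (X · ω) J = z} = (J.card)! * multinomialWeight p z)
    {y : α → ℕ} (hy : ∑ b, y b = J.card + 1) :
    μ.real (X j ⁻¹' {a} ∩ {ω | typeCount (X · ω) J + Pi.single a 1 = y}) =
      (J.card)! * (y a * multinomialWeight p y) := by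
  rcases Nat.eq_zero_or_pos (y a) with h0 | hpos
  · have : {ω | typeCount (X · ω) J + Pi.single a 1 = y} = ∅ :=
      Set.eq_empty_of_forall_notMem fun ω hω => by simpa [h0] using congrFun hω a
    simp [this, h0]
  · obtain ⟨z, rfl⟩ : ∃ z, y = z + Pi.single a 1 :=
      ⟨y - Pi.single a 1, (tsub_add_cancel_of_le
        (update_le_iff.2 ⟨hpos, fun _ _ => Nat.zero_le _⟩)).symm⟩
    have hz : ∑ b, z b = J.card := by simpa [Finset.sum_add_distrib] using hy
    have h := congrArg ENNReal.toReal <|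
      (indepFun_typeCount hX hindep hj).measure_inter_preimage_eq_mul
        {a} {z} (measurableSet_singleton a) (measurableSet_singleton z)
    rw [ENNReal.toReal_mul] at h
    have hcast : (((z + Pi.single a 1 : α → ℕ) a : ℕ) : ℝ) = z a + 1 := by simp
    rw [hcast, multinomialWeight_add_single, mul_left_comm, ← hJ z hz, ← hp]
    simp only [add_left_inj]
    exact h

lemma measureReal_typeCount_eq [Fintype α] (hX : ∀ j, Measurable (X j)) (hindep : iIndepFun X μ)
    {p : α → ℝ} (hp : ∀ j a, μ.real (X j ⁻¹' {a}) = p a) {J : Finset ι} {y : α → ℕ}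
    (hy : ∑ a, y a = J.card) :
    μ.real {ω | typeCount (X · ω) J = y} = (J.card)! * multinomialWeight p y := by
  classical
  have := hindep.isProbabilityMeasure
  induction J using Finset.induction_on generalizing y with
  | empty =>
    obtain rfl : y = 0 := by simpa [Finset.sum_eq_zero_iff, funext_iff] using hy
    simp [typeCount_empty, multinomialWeight]
  | insert j J hj ih =>
    have hunion : {ω | typeCount (X · ω) (insert j J) = y} =
        ⋃ a ∈ Finset.univ, X j ⁻¹' {a} ∩ {ω | typeCount (X · ω) J + Pi.single a 1 = y} := by
      ext ω
      simp [typeCount_insert _ hj]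
    rw [hunion, measureReal_biUnion_finset]
    · rw [Finset.sum_congr rfl fun a _ => measureReal_inter_typeCount_add_single_eq hX hindep hj
        (hp j a) (fun _ => ih) (hy.trans (Finset.card_insert_of_notMem hj)),
        ← Finset.mul_sum, ← Finset.sum_mul, ← Nat.cast_sum, hy,
        Finset.card_insert_of_notMem hj, Nat.factorial_succ]
      push_cast
      ring
    · exact fun a _ b _ hab => ((Set.disjoint_singleton.2 hab).preimage (X j)).mono
        Set.inter_subset_left Set.inter_subset_left
    · exact fun a _ => (hX j (measurableSet_singleton a)).inter
        (((measurable_typeCount fun j _ => hX j).add_const _) (measurableSet_singleton y))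

end Multinomial

section Blocks

variable {κ : Type*} [LinearOrder κ] [LocallyFiniteOrderBot κ]

/-- The `s`-th of the successive blocks of arrivals of lengths `d u`, with `u` running through
`κ` in increasing order. -/
def block (d : κ → ℕ) (s : κ) : Finset ℕ :=
  Finset.Ico (∑ u ∈ Finset.Iio s, d u) (∑ u ∈ Finset.Iic s, d u)

lemma card_block (d : κ → ℕ) (s : κ) : (block d s).card = d s := by
  rw [block, Nat.card_Ico, ← Finset.Iio_insert, Finset.sum_insert (by simp),
    Nat.add_sub_cancel]

lemma pairwise_disjoint_block (d : κ → ℕ) : Pairwise (Function.onFun Disjoint (block d)) := by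
  refine (pairwise_disjoint_on _).2 fun s t hst => ?_
  have hle : ∑ u ∈ Finset.Iic s, d u ≤ ∑ u ∈ Finset.Iio t, d u :=
    Finset.sum_le_sum_of_subset fun u hu => Finset.mem_Iio.2 ((Finset.mem_Iic.1 hu).trans_lt hst)
  exact Finset.disjoint_left.2 fun j hj hj' =>
    ((Finset.mem_Ico.1 hj).2.trans_le (hle.trans (Finset.mem_Ico.1 hj').1)).false

lemma biUnion_block (d : κ → ℕ) (r : κ) :
    (Finset.Iic r).biUnion (block d) = Finset.range (∑ u ∈ Finset.Iic r, d u) := by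
  refine Finset.eq_of_subset_of_card_le (Finset.biUnion_subset.2 fun s hs j hj => ?_) ?_
  · exact Finset.mem_range.2 <| (Finset.mem_Ico.1 hj).2.trans_le <|
      Finset.sum_le_sum_of_subset <| Finset.Iic_subset_Iic.2 (Finset.mem_Iic.1 hs)
  · rw [Finset.card_biUnion fun s _ t _ hst => pairwise_disjoint_block d hst, Finset.card_range]
    simp only [card_block, le_refl]

lemma typeCount_range_sum_Iic {α : Type*} [DecidableEq α] (x : ℕ → α) (d : κ → ℕ) (r : κ) (a : α) :
    typeCount x (Finset.range (∑ u ∈ Finset.Iic r, d u)) a =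
      ∑ u ∈ Finset.Iic r, typeCount x (block d u) a := by
  rw [← biUnion_block, typeCount_biUnion x ((pairwise_disjoint_block d).set_pairwise _)]

end Blocks

section PoissonSplitting

/-- The law of a family of independent Poisson variables with rates `a s`. -/
noncomputable def poissonPi {κ : Type*} [Fintype κ] (a : κ → ℝ≥0) : Measure (κ → ℕ) :=
  Measure.pi fun s => poissonMeasure (a s)

instance {κ : Type*} [Fintype κ] (a : κ → ℝ≥0) : IsProbabilityMeasure (poissonPi a) :=
  inferInstanceAs (IsProbabilityMeasure (Measure.pi _))

lemma poissonMeasure_mul_multinomialWeight {α : Type*} [Fintype α] {p : α → ℝ≥0}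
    (hp : ∑ a, p a = 1) (t : ℝ≥0) (y : α → ℕ) :
    (poissonMeasure t).real {∑ a, y a} * ((∑ a, y a)! * multinomialWeight (fun a => p a) y) =
      ∏ a, (poissonMeasure (p a * t)).real {y a} := by
  have hexp : ∏ a, Real.exp (-(p a * t)) = Real.exp (-t) := by
    rw [← Real.exp_sum, Finset.sum_neg_distrib, ← Finset.sum_mul, ← NNReal.coe_sum, hp,
      NNReal.coe_one, one_mul]
  have hfac : ((∑ a, y a)! : ℝ) ≠ 0 := by positivity
  simp only [poissonMeasure_real_singleton, Finset.prod_div_distrib, Finset.prod_mul_distrib,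
    multinomialWeight, NNReal.coe_mul, hexp, mul_pow, Finset.prod_pow_eq_pow_sum]
  field_simp

variable {Ω α κ : Type*} [MeasurableSpace Ω] {μ : Measure Ω} [DecidableEq α] [MeasurableSpace α]
  [MeasurableSingletonClass α] [LinearOrder κ] [LocallyFiniteOrderBot κ] {X : ℕ → Ω → α}

lemma measurable_typeCount_block [Finite κ] (hX : ∀ j, Measurable (X j)) :
    Measurable fun (q : Ω × (κ → ℕ)) a s => typeCount (X · q.1) (block q.2 s) a := by
  refine measurable_from_prod_countable_left fun d => measurable_pi_lambda _ fun a =>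
    measurable_pi_lambda _ fun s => ?_
  exact (measurable_pi_apply a).comp (measurable_typeCount (J := block d s) fun j _ => hX j)

variable [Fintype α] [Fintype κ]

lemma measureReal_typeCount_block_eq (hX : ∀ j, Measurable (X j)) (hindep : iIndepFun X μ)
    {p : α → ℝ} (hp : ∀ j a, μ.real (X j ⁻¹' {a}) = p a) (y : α → κ → ℕ) :
    μ.real {ω | ∀ s, typeCount (X · ω) (block (fun s => ∑ a, y a s) s) = (y · s)} =
      ∏ s, (∑ a, y a s)! * multinomialWeight p (y · s) := by
  have h := (iIndepFun_typeCount hX hindep (pairwise_disjoint_block fun s => ∑ a, y a s))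
    |>.measure_inter_preimage_eq_mul Finset.univ (sets := fun s => {(y · s)})
      fun s _ => measurableSet_singleton _
  have hset : {ω | ∀ s, typeCount (X · ω) (block (fun s => ∑ a, y a s) s) = (y · s)} =
      ⋂ s ∈ Finset.univ,
        (fun ω => typeCount (X · ω) (block (fun s => ∑ a, y a s) s)) ⁻¹' {(y · s)} := by
    ext ω
    simp
  rw [hset, measureReal_def, h, ENNReal.toReal_prod]
  refine Finset.prod_congr rfl fun s _ => ?_
  rw [← card_block (fun s => ∑ a, y a s) s,
    ← measureReal_typeCount_eq hX hindep hp (card_block (fun s => ∑ a, y a s) s).symm]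
  rfl

theorem map_typeCount_block (hX : ∀ j, Measurable (X j)) (hindep : iIndepFun X μ)
    {p : α → ℝ≥0} (hp : ∀ j a, μ.real (X j ⁻¹' {a}) = p a) (t : κ → ℝ≥0) :
    (μ.prod (poissonPi t)).map (fun q a s => typeCount (X · q.1) (block q.2 s) a) =
      Measure.pi fun a => poissonPi fun s => p a * t s := by
  have := hindep.isProbabilityMeasure
  have hsum : ∑ a, p a = 1 := by
    have h := sum_measureReal_preimage_singleton (μ := μ) (f := X 0) Finset.univ
      fun a _ => hX 0 (measurableSet_singleton a)
    simp only [hp, Finset.coe_univ, Set.preimage_univ, probReal_univ] at h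
    exact_mod_cast h
  refine Measure.ext_of_singleton fun y => ?_
  have hpre : (fun (q : Ω × (κ → ℕ)) a s => typeCount (X · q.1) (block q.2 s) a) ⁻¹' {y} =
      {ω | ∀ s, typeCount (X · ω) (block (fun s => ∑ a, y a s) s) = (y · s)} ×ˢ
        {fun s => ∑ a, y a s} := by
    ext ⟨ω, d⟩
    simp only [Set.mem_preimage, Set.mem_singleton_iff, Set.mem_prod, Set.mem_ofPred_eq]
    refine ⟨fun h => ?_, ?_⟩
    · obtain rfl : d = fun s => ∑ a, y a s := by
        ext s
        rw [← h, sum_typeCount, card_block]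
      exact ⟨fun s => funext fun a => congrFun₂ h a s, rfl⟩
    · rintro ⟨h, rfl⟩
      exact funext₂ fun a s => congrFun (h s) a
  rw [Measure.map_apply (measurable_typeCount_block hX) (measurableSet_singleton y), hpre,
    ← ENNReal.toReal_eq_toReal_iff' (by finiteness) (by finiteness), Measure.prod_prod,
    ENNReal.toReal_mul, ← measureReal_def, measureReal_typeCount_block_eq hX hindep hp]
  simp only [poissonPi, Measure.pi_singleton, ENNReal.toReal_prod, ← measureReal_def]
  rw [mul_comm, ← Finset.prod_mul_distrib, Finset.prod_comm]
  exact Finset.prod_congr rfl fun s _ => poissonMeasure_mul_multinomialWeight hsum (t s) (y · s)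

end PoissonSplitting

section Poisson

lemma hasSum_descFactorial_mul_poisson (a : ℝ≥0) (k : ℕ) :
    HasSum (fun m : ℕ => (m.descFactorial k : ℝ) * (Real.exp (-a) * (a : ℝ) ^ m / m !))
      ((a : ℝ) ^ k) := by
  have hzero : ∑ m ∈ Finset.range k,
      (m.descFactorial k : ℝ) * (Real.exp (-a) * (a : ℝ) ^ m / m !) = 0 :=
    Finset.sum_eq_zero fun m hm => by
      rw [Nat.descFactorial_of_lt (Finset.mem_range.1 hm), Nat.cast_zero, zero_mul]
  rw [← hasSum_nat_add_iff' k, hzero, sub_zero]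
  have hshift : ∀ m : ℕ, ((m + k).descFactorial k : ℝ) *
      (Real.exp (-a) * (a : ℝ) ^ (m + k) / (m + k)!) =
      (a : ℝ) ^ k * (Real.exp (-a) * (a : ℝ) ^ m / m !) := fun m => by
    have hfac : ((m + k)! : ℝ) = m ! * (m + k).descFactorial k := by
      rw [← Nat.factorial_mul_descFactorial (Nat.le_add_left k m), Nat.add_sub_cancel,
        Nat.cast_mul]
    have hne : ((m + k).descFactorial k : ℝ) ≠ 0 := by simp [Nat.descFactorial_eq_zero_iff_lt]
    rw [hfac, pow_add]
    field_simp
  have h := (hasSum_one_poissonMeasure a).mul_left ((a : ℝ) ^ k)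
  rw [mul_one] at h
  simpa only [hshift] using h

lemma hasSum_sq_sub_mul_poisson (a : ℝ≥0) :
    HasSum (fun m : ℕ => Real.exp (-a) * (a : ℝ) ^ m / m ! * ((m : ℝ) - a) ^ 2) a := by
  have h := ((hasSum_descFactorial_mul_poisson a 2).add
    ((hasSum_descFactorial_mul_poisson a 1).mul_left (1 - 2 * (a : ℝ)))).add
    ((hasSum_descFactorial_mul_poisson a 0).mul_left ((a : ℝ) ^ 2))
  convert h using 1
  · ext m
    rw [Nat.cast_descFactorial_two, Nat.descFactorial_one, Nat.descFactorial_zero]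
    push_cast
    ring
  · ring

lemma measureReal_poissonMeasure_le_abs_sub_le (a : ℝ≥0) {c : ℝ} (hc : 0 < c) :
    (poissonMeasure a).real {m : ℕ | c ≤ |(m : ℝ) - a|} ≤ a / c ^ 2 := by
  have hint : Integrable (fun m : ℕ => ((m : ℝ) - a) ^ 2) (poissonMeasure a) := by
    rw [integrable_poissonMeasure_iff]
    refine (hasSum_sq_sub_mul_poisson a).summable.congr fun m => ?_
    rw [Real.norm_of_nonneg (sq_nonneg _)]
  have hval : ∫ m : ℕ, ((m : ℝ) - a) ^ 2 ∂(poissonMeasure a) = a := by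
    rw [integral_poissonMeasure]
    exact (hasSum_sq_sub_mul_poisson a).tsum_eq
  have hset : {m : ℕ | c ≤ |(m : ℝ) - a|} = {m : ℕ | c ^ 2 ≤ ((m : ℝ) - a) ^ 2} := by
    ext m
    rw [Set.mem_ofPred_eq, Set.mem_ofPred_eq, sq_le_sq, abs_of_pos hc]
  rw [le_div_iff₀' (by positivity), hset]
  exact (mul_meas_ge_le_integral_of_nonneg (Eventually.of_forall fun m => sq_nonneg _) hint _).trans
    hval.le

open Asymptotics in
lemma isEquivalent_poissonMeasure_Iic (r : ℕ) :
    (fun a : ℝ≥0 => (poissonMeasure a).real (Set.Iic r)) ~[atTop]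
      fun a => Real.exp (-a) * (a : ℝ) ^ r / r ! := by
  induction r with
  | zero =>
    simp_rw [← poissonMeasure_real_singleton, ← Nat.bot_eq_zero, Set.Iic_bot]
    exact IsEquivalent.refl
  | succ r ih =>
    have hsplit : ∀ a : ℝ≥0, (poissonMeasure a).real (Set.Iic (r + 1)) =
        Real.exp (-a) * (a : ℝ) ^ (r + 1) / (r + 1)! + (poissonMeasure a).real (Set.Iic r) :=
      fun a => by
        rw [← poissonMeasure_real_singleton, ← measureReal_union
          (Set.disjoint_left.2 fun j hj => by simp_all) measurableSet_Iic]
        congr 1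
        ext j
        simp only [Set.mem_Iic, Set.mem_union, Set.mem_singleton_iff]
        omega
    have hlittle : (fun a : ℝ≥0 => Real.exp (-a) * (a : ℝ) ^ r / r !) =o[atTop]
        fun a => Real.exp (-a) * (a : ℝ) ^ (r + 1) / (r + 1)! := by
      refine isLittleO_of_tendsto' ?_ ?_
      · filter_upwards [eventually_gt_atTop 0] with a ha h
        exact absurd h (by positivity)
      · refine (tendsto_const_nhds (x := (r + 1 : ℝ))).div_atTop
          (NNReal.tendsto_coe_atTop.2 tendsto_id) |>.congr' ?_
        filter_upwards [eventually_gt_atTop 0] with a ha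
        have ha' : (a : ℝ) ≠ 0 := by positivity
        rw [Nat.factorial_succ, pow_succ, id]
        push_cast
        field_simp
    simp_rw [hsplit]
    exact IsEquivalent.refl.add_isLittleO (ih.trans_isLittleO hlittle)

lemma tendsto_poissonMeasure_Iic_zero (r : ℕ) :
    Tendsto (fun a : ℝ≥0 => (poissonMeasure a).real (Set.Iic r)) atTop (𝓝 0) := by
  refine (isEquivalent_poissonMeasure_Iic r).tendsto_nhds_iff.2 ?_
  have h := ((Real.tendsto_pow_mul_exp_neg_atTop_nhds_zero r).comp
    (NNReal.tendsto_coe_atTop.2 tendsto_id)).div_const (r ! : ℝ)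
  rw [zero_div] at h
  exact h.congr fun a => by simp [mul_comm]

lemma poissonMeasure_zero : poissonMeasure 0 = Measure.dirac 0 := by
  refine Measure.ext_of_singleton fun j => ?_
  rw [poissonMeasure_singleton, Measure.dirac_apply' _ (measurableSet_singleton j)]
  rcases j with _ | j <;> simp

end Poisson

section PoissonPi

variable {κ : Type*} [Fintype κ] (a : κ → ℝ≥0)

lemma iIndepFun_eval_poissonPi :
    iIndepFun (fun (u : κ) (z : κ → ℕ) => z u) (poissonPi a) :=
  iIndepFun_pi (X := fun _ => id) fun _ => aemeasurable_id

lemma measureReal_forall_mem_poissonPi (T : Finset κ) (B : Set ℕ) :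
    (poissonPi a).real {z | ∀ u ∈ T, z u ∈ B} = ∏ u ∈ T, (poissonMeasure (a u)).real B := by
  have h := (iIndepFun_eval_poissonPi a).measure_inter_preimage_eq_mul T (sets := fun _ => B)
    fun u _ => B.to_countable.measurableSet
  have hset : {z : κ → ℕ | ∀ u ∈ T, z u ∈ B} = ⋂ u ∈ T, (fun z => z u) ⁻¹' B := by
    ext z
    simp
  rw [hset, measureReal_def, h, ENNReal.toReal_prod]
  refine Finset.prod_congr rfl fun u _ => ?_
  exact congrArg ENNReal.toReal <|
    (measurePreserving_eval (fun s => poissonMeasure (a s)) u).measure_preimage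
      B.to_countable.measurableSet.nullMeasurableSet

lemma hasLaw_sum_poissonPi (T : Finset κ) :
    HasLaw (∑ u ∈ T, fun z : κ → ℕ => z u) (poissonMeasure (∑ u ∈ T, a u)) (poissonPi a) := by
  classical
  induction T using Finset.induction_on with
  | empty =>
    refine ⟨by fun_prop, ?_⟩
    rw [Finset.sum_empty, Finset.sum_empty, poissonMeasure_zero]
    exact (Measure.map_const _ 0).trans (by simp)
  | insert u T hu ih =>
    rw [Finset.sum_insert hu, Finset.sum_insert hu, add_comm, add_comm (a u)]
    exact IndepFun.hasLaw_add_poissonMeasure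
      ((iIndepFun_eval_poissonPi a).indepFun_finsetSum_of_notMem measurable_pi_apply hu) ih
      (measurePreserving_eval (fun s => poissonMeasure (a s)) u).hasLaw

lemma measureReal_sum_mem_poissonPi (T : Finset κ) (A : Set ℕ) :
    (poissonPi a).real {z | ∑ u ∈ T, z u ∈ A} = (poissonMeasure (∑ u ∈ T, a u)).real A := by
  have h := hasLaw_sum_poissonPi a T
  rw [← h.map_eq, map_measureReal_apply_of_aemeasurable h.aemeasurable
    A.to_countable.measurableSet]
  congr 1
  ext z
  simp

lemma measureReal_sum_mem_inter_forall_mem_poissonPi {S T : Finset κ} (hST : Disjoint S T)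
    (A B : Set ℕ) :
    (poissonPi a).real ({z | ∑ u ∈ S, z u ∈ A} ∩ {z | ∀ u ∈ T, z u ∈ B}) =
      (poissonMeasure (∑ u ∈ S, a u)).real A * ∏ u ∈ T, (poissonMeasure (a u)).real B := by
  have h := (iIndepFun_eval_poissonPi a).indepFun_finset S T hST measurable_pi_apply
    |>.measure_inter_preimage_eq_mul {y | ∑ u, y u ∈ A} {y | ∀ u, y u ∈ B}
      (Set.to_countable _).measurableSet (Set.to_countable _).measurableSet
  rw [← measureReal_sum_mem_poissonPi, ← measureReal_forall_mem_poissonPi]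
  simp only [Set.preimage_ofPred_eq, Finset.sum_coe_sort S, Subtype.forall] at h
  rw [measureReal_def, h, ENNReal.toReal_mul]
  rfl

end PoissonPi

section DePoissonization

lemma measureReal_prod_mem_le_of_monotone {Ω Δ ι : Type*} [MeasurableSpace Ω] [MeasurableSpace Δ]
    {μ : Measure Ω} {ν : Measure Δ} [IsProbabilityMeasure μ] [IsProbabilityMeasure ν] [Preorder ι]
    {C : ι → Set Ω} (hC : Monotone C) (D : Δ → ι) (m : ι) :
    (μ.prod ν).real {q | q.1 ∈ C (D q.2)} ≤ μ.real (C m) + ν.real {d | ¬ D d ≤ m} := by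
  have hsub : {q : Ω × Δ | q.1 ∈ C (D q.2)} ⊆
      C m ×ˢ Set.univ ∪ Set.univ ×ˢ {d | ¬ D d ≤ m} := fun q hq =>
    (em (D q.2 ≤ m)).imp (fun h => ⟨hC h hq, trivial⟩) fun h => ⟨trivial, h⟩
  calc (μ.prod ν).real {q | q.1 ∈ C (D q.2)}
      ≤ (μ.prod ν).real (C m ×ˢ Set.univ) + (μ.prod ν).real (Set.univ ×ˢ {d | ¬ D d ≤ m}) :=
        (measureReal_mono hsub).trans (measureReal_union_le _ _)
    _ = μ.real (C m) + ν.real {d | ¬ D d ≤ m} := by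
        rw [measureReal_prod_prod, measureReal_prod_prod, probReal_univ, probReal_univ, mul_one,
          one_mul]

lemma measureReal_le_prod_mem_of_monotone {Ω Δ ι : Type*} [MeasurableSpace Ω] [MeasurableSpace Δ]
    {μ : Measure Ω} {ν : Measure Δ} [IsProbabilityMeasure μ] [IsProbabilityMeasure ν] [Preorder ι]
    {C : ι → Set Ω} (hC : Monotone C) (D : Δ → ι) (m : ι) :
    μ.real (C m) ≤ (μ.prod ν).real {q | q.1 ∈ C (D q.2)} + ν.real {d | ¬ m ≤ D d} := by
  have hsub : C m ×ˢ Set.univ ⊆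
      {q : Ω × Δ | q.1 ∈ C (D q.2)} ∪ Set.univ ×ˢ {d | ¬ m ≤ D d} := fun q hq =>
    (em (m ≤ D q.2)).imp (fun h => hC h hq.1) fun h => ⟨trivial, h⟩
  calc μ.real (C m)
      = (μ.prod ν).real (C m ×ˢ Set.univ) := by
        rw [measureReal_prod_prod, probReal_univ, mul_one]
    _ ≤ (μ.prod ν).real {q | q.1 ∈ C (D q.2)} + (μ.prod ν).real (Set.univ ×ˢ {d | ¬ m ≤ D d}) :=
        (measureReal_mono hsub).trans (measureReal_union_le _ _)
    _ = (μ.prod ν).real {q | q.1 ∈ C (D q.2)} + ν.real {d | ¬ m ≤ D d} := by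
        rw [measureReal_prod_prod, probReal_univ, one_mul]

variable {Ω α κ : Type*} [DecidableEq α]

/-- The event that, for every `r`, each type occurs more than `k r` times among the first `m r`
coupons; for `k r = r` this says that collector `r` is done by time `m r`. -/
def completedEvent (X : ℕ → Ω → α) (k m : κ → ℕ) : Set Ω :=
  {ω | ∀ r a, k r < typeCount (X · ω) (Finset.range (m r)) a}

lemma monotone_completedEvent (X : ℕ → Ω → α) (k : κ → ℕ) : Monotone (completedEvent X k) :=
  fun _ _ hm _ hω r a => (hω r a).trans_le <|
    typeCount_mono _ (Finset.range_subset_range.2 (hm r)) a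

variable [Fintype κ] [LinearOrder κ] [LocallyFiniteOrderBot κ]

lemma measureReal_poissonPi_exists_le_abs_sub_le (t : κ → ℝ≥0) {c : ℝ} (hc : 0 < c) :
    (poissonPi t).real {d | ∃ r, c ≤ |((∑ u ∈ Finset.Iic r, d u : ℕ) : ℝ) -
      (∑ u ∈ Finset.Iic r, t u : ℝ≥0)|} ≤
      ∑ r, (∑ u ∈ Finset.Iic r, t u : ℝ≥0) / c ^ 2 := by
  rw [Set.ofPred_exists, ← Set.biUnion_univ, ← Finset.coe_univ]
  refine (measureReal_biUnion_finset_le _ _).trans (Finset.sum_le_sum fun r _ => ?_)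
  refine le_of_eq_of_le ?_ (measureReal_poissonMeasure_le_abs_sub_le _ hc)
  exact measureReal_sum_mem_poissonPi t (Finset.Iic r)
    {j : ℕ | c ≤ |(j : ℝ) - (∑ u ∈ Finset.Iic r, t u : ℝ≥0)|}

variable [Fintype α] [MeasurableSpace Ω] {μ : Measure Ω} [MeasurableSpace α]
  [MeasurableSingletonClass α] {X : ℕ → Ω → α}

lemma measureReal_prod_mem_completedEvent (hX : ∀ j, Measurable (X j)) (hindep : iIndepFun X μ)
    {p : α → ℝ≥0} (hp : ∀ j a, μ.real (X j ⁻¹' {a}) = p a) (k : κ → ℕ) (t : κ → ℝ≥0) :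
    (μ.prod (poissonPi t)).real
      {q | q.1 ∈ completedEvent X k fun r => ∑ u ∈ Finset.Iic r, q.2 u} =
    ∏ a, (poissonPi fun s => p a * t s).real {z | ∀ r, k r < ∑ u ∈ Finset.Iic r, z u} := by
  have hset : {q : Ω × (κ → ℕ) | q.1 ∈ completedEvent X k fun r => ∑ u ∈ Finset.Iic r, q.2 u} =
      (fun q a s => typeCount (X · q.1) (block q.2 s) a) ⁻¹'
        Set.univ.pi fun _ => {z | ∀ r, k r < ∑ u ∈ Finset.Iic r, z u} := by
    ext q
    simp only [completedEvent, typeCount_range_sum_Iic, Set.mem_ofPred_eq, Set.mem_preimage,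
      Set.mem_univ_pi]
    exact forall_comm
  rw [hset, ← map_measureReal_apply (measurable_typeCount_block hX)
    (Set.to_countable _).measurableSet, map_typeCount_block hX hindep hp]
  simp only [measureReal_def, Measure.pi_pi, ENNReal.toReal_prod]

theorem prod_poissonPi_le_measureReal_completedEvent (hX : ∀ j, Measurable (X j))
    (hindep : iIndepFun X μ) {p : α → ℝ≥0} (hp : ∀ j a, μ.real (X j ⁻¹' {a}) = p a)
    (k : κ → ℕ) {t : κ → ℝ≥0} {m : κ → ℕ} {c : ℝ} (hc : 0 < c)
    (hm : ∀ r, (∑ u ∈ Finset.Iic r, t u : ℝ≥0) + c ≤ m r + 1) :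
    ∏ a, (poissonPi fun s => p a * t s).real {z | ∀ r, k r < ∑ u ∈ Finset.Iic r, z u} ≤
      μ.real (completedEvent X k m) + ∑ r, (∑ u ∈ Finset.Iic r, t u : ℝ≥0) / c ^ 2 := by
  have := hindep.isProbabilityMeasure
  rw [← measureReal_prod_mem_completedEvent hX hindep hp]
  refine (measureReal_prod_mem_le_of_monotone (monotone_completedEvent X k)
    (fun (d : κ → ℕ) r => ∑ u ∈ Finset.Iic r, d u) m).trans ?_
  refine add_le_add_right (le_trans (measureReal_mono fun d hd => ?_)
    (measureReal_poissonPi_exists_le_abs_sub_le t hc)) _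
  obtain ⟨r, hr⟩ := not_forall.1 hd
  have hr' : (m r + 1 : ℝ) ≤ (∑ u ∈ Finset.Iic r, d u : ℕ) := by exact_mod_cast not_le.1 hr
  exact ⟨r, le_trans (by linarith [hm r]) (le_abs_self _)⟩

theorem measureReal_completedEvent_le_prod_poissonPi (hX : ∀ j, Measurable (X j))
    (hindep : iIndepFun X μ) {p : α → ℝ≥0} (hp : ∀ j a, μ.real (X j ⁻¹' {a}) = p a)
    (k : κ → ℕ) {t : κ → ℝ≥0} {m : κ → ℕ} {c : ℝ} (hc : 0 < c)
    (hm : ∀ r, m r + c ≤ (∑ u ∈ Finset.Iic r, t u : ℝ≥0)) :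
    μ.real (completedEvent X k m) ≤
      ∏ a, (poissonPi fun s => p a * t s).real {z | ∀ r, k r < ∑ u ∈ Finset.Iic r, z u} +
        ∑ r, (∑ u ∈ Finset.Iic r, t u : ℝ≥0) / c ^ 2 := by
  have := hindep.isProbabilityMeasure
  rw [← measureReal_prod_mem_completedEvent hX hindep hp]
  refine (measureReal_le_prod_mem_of_monotone (ν := poissonPi t)
    (monotone_completedEvent X k) (fun (d : κ → ℕ) r => ∑ u ∈ Finset.Iic r, d u) m).trans ?_
  refine add_le_add_right (le_trans (measureReal_mono fun d hd => ?_)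
    (measureReal_poissonPi_exists_le_abs_sub_le t hc)) _
  obtain ⟨r, hr⟩ := not_forall.1 hd
  have hr' : ((∑ u ∈ Finset.Iic r, d u : ℕ) : ℝ) ≤ m r := by exact_mod_cast (not_le.1 hr).le
  exact ⟨r, le_trans (by linarith [hm r]) (neg_le_abs _)⟩

end DePoissonization

section PoissonPartialSums

variable {κ : Type*} [Fintype κ] [LinearOrder κ] [LocallyFiniteOrderBot κ]

lemma one_sub_poissonPi_forall_lt_sum_le (a : κ → ℝ≥0) (k : κ → ℕ) :
    1 - (poissonPi a).real {z | ∀ r, k r < ∑ u ∈ Finset.Iic r, z u} ≤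
      ∑ r, (poissonMeasure (∑ u ∈ Finset.Iic r, a u)).real (Set.Iic (k r)) := by
  have hcompl : {z : κ → ℕ | ∀ r, k r < ∑ u ∈ Finset.Iic r, z u}ᶜ =
      ⋃ r ∈ Finset.univ, {z | ∑ u ∈ Finset.Iic r, z u ∈ Set.Iic (k r)} := by
    ext z
    simp
  rw [← probReal_compl_eq_one_sub (Set.to_countable _).measurableSet, hcompl]
  simp_rw [← measureReal_sum_mem_poissonPi]
  exact measureReal_biUnion_finset_le _ _

-- If the increments after `r` all exceed `K ≥ k`, then `r` is the last index at which the partial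
-- sum is at most `k`; this makes the events below disjoint.
lemma sum_mul_prod_le_one_sub_poissonPi_forall_lt_sum (a : κ → ℝ≥0) {k : κ → ℕ} {K : ℕ}
    (hk : ∀ r, k r ≤ K) :
    ∑ r, (poissonMeasure (∑ u ∈ Finset.Iic r, a u)).real (Set.Iic (k r)) *
        ∏ u ∈ (Finset.Iic r)ᶜ, (poissonMeasure (a u)).real (Set.Ioi K) ≤
      1 - (poissonPi a).real {z | ∀ r, k r < ∑ u ∈ Finset.Iic r, z u} := by
  let F : κ → Set (κ → ℕ) := fun r => {z | ∑ u ∈ Finset.Iic r, z u ∈ Set.Iic (k r)} ∩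
    {z | ∀ u ∈ (Finset.Iic r)ᶜ, z u ∈ Set.Ioi K}
  have hdisj : Pairwise (Function.onFun Disjoint F) := by
    refine (pairwise_disjoint_on F).2 fun r s hrs => Set.disjoint_left.2 fun z hr hs => ?_
    have hlarge : K < z s := hr.2 s (by simpa using hrs)
    have hsmall : z s ≤ K := (Finset.single_le_sum_of_canonicallyOrdered
      (Finset.mem_Iic.2 le_rfl)).trans ((Set.mem_Iic.1 hs.1).trans (hk s))
    exact hlarge.not_ge hsmall
  have hsub : ⋃ r ∈ Finset.univ, F r ⊆ {z | ∀ r, k r < ∑ u ∈ Finset.Iic r, z u}ᶜ := by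
    refine Set.iUnion₂_subset fun r _ z hz hz' => ?_
    exact (hz' r).not_ge hz.1
  simp_rw [← measureReal_sum_mem_inter_forall_mem_poissonPi a disjoint_compl_right]
  rw [← measureReal_biUnion_finset (hdisj.set_pairwise _)
    fun r _ => (Set.to_countable (F r)).measurableSet,
    ← probReal_compl_eq_one_sub (Set.to_countable _).measurableSet]
  exact measureReal_mono hsub

theorem tendsto_poissonPi_forall_lt_sum_pow {a : ℕ → κ → ℝ≥0} {k : κ → ℕ} {c : κ → ℝ}
    (hc : ∀ r, Tendsto (fun n : ℕ => n *
      (poissonMeasure (∑ u ∈ Finset.Iic r, a n u)).real (Set.Iic (k r))) atTop (𝓝 (c r)))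
    (ha : ∀ r, Tendsto (a · r) atTop atTop) :
    Tendsto (fun n => (poissonPi (a n)).real {z | ∀ r, k r < ∑ u ∈ Finset.Iic r, z u} ^ n) atTop
      (𝓝 (Real.exp (-∑ r, c r))) := by
  obtain ⟨K, hK⟩ : ∃ K, ∀ r, k r ≤ K := ⟨Finset.univ.sup k, fun r => Finset.le_sup (by simp)⟩
  have hlarge : ∀ u, Tendsto (fun n => (poissonMeasure (a n u)).real (Set.Ioi K)) atTop (𝓝 1) :=
    fun u => by
      have h := ((tendsto_poissonMeasure_Iic_zero K).comp (ha u)).const_sub 1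
      rw [sub_zero] at h
      refine h.congr fun n => ?_
      rw [Function.comp, ← probReal_compl_eq_one_sub measurableSet_Iic, Set.compl_Iic]
  have hlower : Tendsto (fun n : ℕ => n * ∑ r,
      (poissonMeasure (∑ u ∈ Finset.Iic r, a n u)).real (Set.Iic (k r)) *
        ∏ u ∈ (Finset.Iic r)ᶜ, (poissonMeasure (a n u)).real (Set.Ioi K)) atTop
      (𝓝 (∑ r, c r)) := by
    have h := tendsto_finsetSum Finset.univ fun r _ =>
      (hc r).mul (tendsto_finsetProd (Finset.Iic r)ᶜ fun u _ => hlarge u)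
    simpa only [Finset.prod_const_one, mul_one, Finset.mul_sum, mul_assoc] using h
  have hupper : Tendsto (fun n : ℕ => n * ∑ r,
      (poissonMeasure (∑ u ∈ Finset.Iic r, a n u)).real (Set.Iic (k r))) atTop
      (𝓝 (∑ r, c r)) := by
    simpa only [Finset.mul_sum] using tendsto_finsetSum Finset.univ fun r _ => hc r
  have hlim := tendsto_of_tendsto_of_tendsto_of_le_of_le hlower hupper
    (fun n => mul_le_mul_of_nonneg_left
      (sum_mul_prod_le_one_sub_poissonPi_forall_lt_sum (a n) hK) n.cast_nonneg)
    (fun n => mul_le_mul_of_nonneg_left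
      (one_sub_poissonPi_forall_lt_sum_le (a n) k) n.cast_nonneg)
  have h := Real.tendsto_one_add_pow_exp_of_tendsto (t := -∑ r, c r)
    (hlim.neg.congr fun n => (mul_neg _ _).symm)
  simpa only [neg_sub, add_sub_cancel] using h

end PoissonPartialSums

section Increments

variable {κ : Type*} [LinearOrder κ] [LocallyFiniteOrderBot κ]

/-- The increment `t u - t v` of a monotone family `t`, where `v` is the predecessor of `u`, or
`t u` if `u` is minimal. -/
def increment (t : κ → ℝ≥0) (u : κ) : ℝ≥0 :=
  t u - (Finset.Iio u).sup t

lemma sum_Iic_increment {t : κ → ℝ≥0} (ht : Monotone t) (r : κ) :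
    ∑ u ∈ Finset.Iic r, increment t u = t r := by
  have hIio : StrictMono (Finset.Iio : κ → Finset κ) := fun _ _ => Finset.Iio_ssubset_Iio
  have : WellFoundedLT κ := hIio.wellFoundedLT
  induction r using WellFoundedLT.induction with
  | ind r ih =>
    rw [← Finset.Iio_insert, Finset.sum_insert (by simp), increment]
    rcases (Finset.Iio r).eq_empty_or_nonempty with hempty | hne
    · simp [hempty]
    · obtain ⟨v, hv, hmax⟩ := (Finset.Iio r).exists_maximal hne
      have hvr : v < r := Finset.mem_Iio.1 hv
      have hpred : Finset.Iio r = Finset.Iic v := by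
        ext u
        rw [Finset.mem_Iio, Finset.mem_Iic]
        exact ⟨fun hu => le_of_not_gt fun hvu => hvu.not_ge (hmax (Finset.mem_Iio.2 hu) hvu.le),
          fun hu => hu.trans_lt hvr⟩
      have hsup : (Finset.Iic v).sup t = t v :=
        le_antisymm (Finset.sup_le fun u hu => ht (Finset.mem_Iic.1 hu))
          (Finset.le_sup (Finset.mem_Iic.2 le_rfl))
      rw [hpred, hsup, ih v hvr, tsub_add_cancel_of_le (ht hvr.le)]

lemma tendsto_increment {ι : Type*} {l : Filter ι} {t : ι → κ → ℝ≥0}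
    (h : ∀ r, Tendsto (t · r) l atTop)
    (hsub : ∀ r s, r < s → Tendsto (fun i => t i s - t i r) l atTop) (u : κ) :
    Tendsto (fun i => increment (t i) u) l atTop := by
  refine tendsto_atTop.2 fun b => ?_
  have hpred : ∀ᶠ i in l, ∀ v ∈ Finset.Iio u, b < t i u - t i v :=
    (eventually_all_finset _).2 fun v hv =>
      (hsub v u (Finset.mem_Iio.1 hv)).eventually_gt_atTop b
  filter_upwards [hpred, (h u).eventually_ge_atTop b] with i hi hb
  have hsup : (Finset.Iio u).sup (t i) ≤ t i u - b := Finset.sup_le fun v hv =>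
    le_tsub_of_add_le_left (lt_tsub_iff_right.1 (hi v hv)).le
  exact le_tsub_of_add_le_left (add_le_of_le_tsub_right_of_le hb hsup)

end Increments

section CriticalTime

/-- The critical time `L + r ln L + x` per type, in units where each type arrives at rate one:
with `L = ln n`, the expected number of the `n` types seen at most `r` times tends to
`exp (-x) / r!`. Truncated at zero so as to be a Poisson rate. -/
noncomputable def criticalTime (r : ℕ) (x L : ℝ) : ℝ≥0 :=
  (L + r * Real.log L + x).toNNReal

variable {x : ℝ → ℝ} {y : ℝ}

lemma tendsto_add_mul_log_add_div (hx : Tendsto x atTop (𝓝 y)) (r : ℝ) :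
    Tendsto (fun L : ℝ => (L + r * Real.log L + x L) / L) atTop (𝓝 1) := by
  have hlog : Tendsto (fun L : ℝ => Real.log L / L) atTop (𝓝 0) :=
    Real.isLittleO_log_id_atTop.tendsto_div_nhds_zero
  have h := ((tendsto_const_nhds (x := (1 : ℝ))).add (hlog.const_mul r)).add
    (hx.div_atTop tendsto_id)
  simp only [mul_zero, add_zero] at h
  refine h.congr' ?_
  filter_upwards [eventually_gt_atTop 0] with L hL
  rw [id]
  field_simp

lemma eventually_coe_criticalTime (hx : Tendsto x atTop (𝓝 y)) (r : ℕ) :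
    ∀ᶠ L in atTop, (criticalTime r (x L) L : ℝ) = L + r * Real.log L + x L := by
  filter_upwards [(tendsto_add_mul_log_add_div hx r).eventually_const_lt one_pos,
    eventually_gt_atTop 0] with L h hL
  exact Real.coe_toNNReal _ ((div_pos_iff_of_pos_right hL).1 h).le

lemma eventually_criticalTime_add_le (hx : Tendsto x atTop (𝓝 y)) {x' δ : ℝ → ℝ}
    (hδ : ∀ L, x L + δ L ≤ x' L) (r : ℕ) :
    ∀ᶠ L in atTop, criticalTime r (x L) L + δ L ≤ criticalTime r (x' L) L := by
  filter_upwards [eventually_coe_criticalTime hx r] with L h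
  rw [h]
  exact le_trans (by linarith [hδ L]) (Real.le_coe_toNNReal _)

lemma tendsto_criticalTime_div (hx : Tendsto x atTop (𝓝 y)) (r : ℕ) :
    Tendsto (fun L => (criticalTime r (x L) L : ℝ) / L) atTop (𝓝 1) := by
  refine (tendsto_add_mul_log_add_div hx r).congr' ?_
  filter_upwards [eventually_coe_criticalTime hx r] with L h
  rw [h]

lemma tendsto_criticalTime (hx : Tendsto x atTop (𝓝 y)) (r : ℕ) :
    Tendsto (fun L => criticalTime r (x L) L) atTop atTop := by
  refine NNReal.tendsto_coe_atTop.1 ?_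
  refine ((tendsto_criticalTime_div hx r).pos_mul_atTop one_pos tendsto_id).congr' ?_
  filter_upwards [eventually_ne_atTop 0] with L hL
  exact div_mul_cancel₀ _ hL

lemma tendsto_criticalTime_sub {x' : ℝ → ℝ} {y' : ℝ} (hx : Tendsto x atTop (𝓝 y))
    (hx' : Tendsto x' atTop (𝓝 y')) {r s : ℕ} (hrs : r < s) :
    Tendsto (fun L => criticalTime s (x' L) L - criticalTime r (x L) L) atTop atTop := by
  refine NNReal.tendsto_coe_atTop.1 ?_
  have hrs' : (0 : ℝ) < s - r := sub_pos.2 (Nat.cast_lt.2 hrs)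
  have h := (Real.tendsto_log_atTop.const_mul_atTop hrs').atTop_add (hx'.sub hx)
  refine tendsto_atTop_mono' _ ?_ h
  filter_upwards [eventually_coe_criticalTime hx r, eventually_coe_criticalTime hx' s]
    with L hr hs
  refine le_trans (le_of_eq ?_) (le_max_left _ 0 |>.trans_eq NNReal.coe_sub_def.symm)
  rw [hr, hs]
  ring

open Asymptotics in
lemma tendsto_exp_mul_poissonMeasure_criticalTime (hx : Tendsto x atTop (𝓝 y)) (r : ℕ) :
    Tendsto (fun L => Real.exp L * (poissonMeasure (criticalTime r (x L) L)).real (Set.Iic r))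
      atTop (𝓝 (Real.exp (-y) / r !)) := by
  have hequiv := (IsEquivalent.refl (u := Real.exp) (l := atTop)).mul
    ((isEquivalent_poissonMeasure_Iic r).comp_tendsto (tendsto_criticalTime hx r))
  refine hequiv.symm.tendsto_nhds ?_
  have hlim := ((Real.continuous_exp.tendsto _).comp hx.neg).mul
    ((tendsto_criticalTime_div hx r).pow r) |>.div_const (r ! : ℝ)
  rw [one_pow, mul_one] at hlim
  refine hlim.congr' ?_
  filter_upwards [eventually_coe_criticalTime hx r, eventually_gt_atTop 0] with L h hL
  have hexp : Real.exp (-x L) = Real.exp L * Real.exp (-criticalTime r (x L) L) * L ^ r := by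
    rw [h, ← Real.exp_log hL, ← Real.exp_nat_mul, ← Real.exp_add, ← Real.exp_add, Real.exp_log hL]
    ring_nf
  simp only [Function.comp, Pi.mul_apply]
  rw [hexp, div_pow]
  field_simp

lemma tendsto_criticalTime_mul_sq_div_exp (hx : Tendsto x atTop (𝓝 y)) (r : ℕ) :
    Tendsto (fun L => criticalTime r (x L) L * L ^ 2 / Real.exp L) atTop (𝓝 0) := by
  have h := (tendsto_criticalTime_div hx r).mul (Real.tendsto_pow_mul_exp_neg_atTop_nhds_zero 3)
  rw [mul_zero] at h
  refine h.congr' ?_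
  filter_upwards [eventually_ne_atTop 0] with L hL
  rw [Real.exp_neg]
  field_simp

lemma eventually_monotone_criticalTime {κ : Type*} [Finite κ] [LinearOrder κ] {k : κ → ℕ}
    (hk : StrictMono k) {x : κ → ℝ → ℝ} {y : κ → ℝ} (hx : ∀ r, Tendsto (x r) atTop (𝓝 (y r))) :
    ∀ᶠ L in atTop, Monotone fun r => criticalTime (k r) (x r L) L := by
  have h : ∀ᶠ L in atTop, ∀ r s, r < s →
      criticalTime (k r) (x r L) L ≤ criticalTime (k s) (x s L) L := by
    simp only [eventually_all]
    intro r s hrs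
    filter_upwards [(tendsto_criticalTime_sub (hx r) (hx s) (hk hrs)).eventually_gt_atTop 0]
      with L hL using (tsub_pos_iff_lt.1 hL).le
  filter_upwards [h] with L hL
  exact monotone_iff_forall_lt.2 fun r s hrs => hL r s hrs

end CriticalTime

section UniformTypes

variable {Ω α κ : Type*} [MeasurableSpace Ω] {μ : Measure Ω} [DecidableEq α] [Fintype α]
  [MeasurableSpace α] [MeasurableSingletonClass α] [Fintype κ] [LinearOrder κ]
  [LocallyFiniteOrderBot κ] {X : ℕ → Ω → α}

lemma poissonPi_increment_pow_sub_le (hX : ∀ j, Measurable (X j)) (hindep : iIndepFun X μ)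
    (hunif : ∀ j a, μ.real {ω | X j ω = a} = 1 / Fintype.card α) (k : κ → ℕ) {s t : κ → ℝ≥0}
    (ht : Monotone t) {δ : ℝ} (hδ : 0 < δ) (hts : ∀ r, t r + δ ≤ s r) :
    (poissonPi (increment t)).real {z | ∀ r, k r < ∑ u ∈ Finset.Iic r, z u} ^ Fintype.card α -
      ∑ r, t r / (Fintype.card α * δ ^ 2) ≤
    μ.real (completedEvent X k fun r => ⌊Fintype.card α * s r⌋₊) := by
  have := hindep.isProbabilityMeasure
  have : Nonempty α := μ.nonempty_of_neZero.map (X 0)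
  have hcard : (Fintype.card α : ℝ≥0) ≠ 0 := by simp
  have hfloor : ∀ r, (Fintype.card α * t r : ℝ≥0) + Fintype.card α * δ ≤
      ⌊Fintype.card α * s r⌋₊ + 1 := fun r =>
    calc ((Fintype.card α * t r : ℝ≥0) + Fintype.card α * δ : ℝ)
        = Fintype.card α * (t r + δ) := by push_cast; ring
      _ ≤ Fintype.card α * s r := by gcongr; exact hts r
      _ ≤ ⌊Fintype.card α * s r⌋₊ + 1 := by exact_mod_cast (Nat.lt_floor_add_one _).le
  have h := prod_poissonPi_le_measureReal_completedEvent (p := fun _ => (Fintype.card α : ℝ≥0)⁻¹)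
    (t := fun s => Fintype.card α * increment t s) hX hindep
    (fun j a => (hunif j a).trans (by simp)) k (c := Fintype.card α * δ) (by positivity)
    (by simpa only [← Finset.mul_sum, sum_Iic_increment ht] using hfloor)
  simp only [← Finset.mul_sum, sum_Iic_increment ht, inv_mul_cancel_left₀ hcard,
    Finset.prod_const, Finset.card_univ] at h
  refine sub_le_iff_le_add.2 (h.trans_eq ?_)
  congr! 2 with r
  push_cast
  field_simp

lemma measureReal_completedEvent_le_poissonPi_increment_pow_add (hX : ∀ j, Measurable (X j))
    (hindep : iIndepFun X μ) (hunif : ∀ j a, μ.real {ω | X j ω = a} = 1 / Fintype.card α)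
    (k : κ → ℕ) {s t : κ → ℝ≥0} (ht : Monotone t) {δ : ℝ} (hδ : 0 < δ)
    (hst : ∀ r, s r + δ ≤ t r) :
    μ.real (completedEvent X k fun r => ⌊Fintype.card α * s r⌋₊) ≤
      (poissonPi (increment t)).real {z | ∀ r, k r < ∑ u ∈ Finset.Iic r, z u} ^ Fintype.card α +
        ∑ r, t r / (Fintype.card α * δ ^ 2) := by
  have := hindep.isProbabilityMeasure
  have : Nonempty α := μ.nonempty_of_neZero.map (X 0)
  have hcard : (Fintype.card α : ℝ≥0) ≠ 0 := by simp
  have hfloor : ∀ r, (⌊Fintype.card α * s r⌋₊ : ℝ) + Fintype.card α * δ ≤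
      (Fintype.card α * t r : ℝ≥0) := fun r =>
    calc (⌊Fintype.card α * s r⌋₊ + Fintype.card α * δ : ℝ)
        ≤ Fintype.card α * s r + Fintype.card α * δ := by
          gcongr
          exact_mod_cast Nat.floor_le (zero_le (a := Fintype.card α * s r))
      _ = Fintype.card α * (s r + δ) := by ring
      _ ≤ (Fintype.card α * t r : ℝ≥0) := by push_cast; gcongr; exact hst r
  have h := measureReal_completedEvent_le_prod_poissonPi (p := fun _ => (Fintype.card α : ℝ≥0)⁻¹)
    (t := fun s => Fintype.card α * increment t s) hX hindep
    (fun j a => (hunif j a).trans (by simp)) k (c := Fintype.card α * δ) (by positivity)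
    (by simpa only [← Finset.mul_sum, sum_Iic_increment ht] using hfloor)
  simp only [← Finset.mul_sum, sum_Iic_increment ht, inv_mul_cancel_left₀ hcard,
    Finset.prod_const, Finset.card_univ] at h
  refine h.trans_eq ?_
  congr! 2 with r
  push_cast
  field_simp

end UniformTypes

section FiniteDimensional

lemma normalizedTimes_le_iff {n : ℕ} (hn : 0 < n) {x : ℕ → Fin n} {r : ℕ} {y : ℝ}
    (hy : (criticalTime r y (Real.log n) : ℝ) =
      Real.log n + r * Real.log (Real.log n) + y) :
    normalizedTimes x r ≤ y ↔
      completionTime x r ≤ ⌊n * criticalTime r y (Real.log n)⌋₊ := by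
  have hn' : (0 : ℝ) < n := Nat.cast_pos.2 hn
  rw [Nat.le_floor_iff zero_le, ← NNReal.coe_le_coe, NNReal.coe_mul, hy, NNReal.coe_natCast,
    NNReal.coe_natCast, ← div_le_iff₀' hn', normalizedTimes, sub_le_iff_le_add, sub_le_iff_le_add]
  ring_nf

lemma tendsto_log_natCast : Tendsto (fun n : ℕ => Real.log n) atTop atTop :=
  Real.tendsto_log_atTop.comp tendsto_natCast_atTop_atTop

variable {κ : Type*} [Fintype κ] {k : κ → ℕ}

lemma tendsto_sum_criticalTime_div {x : κ → ℝ → ℝ} {y : κ → ℝ}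
    (hx : ∀ r, Tendsto (x r) atTop (𝓝 (y r))) :
    Tendsto (fun n : ℕ => ∑ r, (criticalTime (k r) (x r (Real.log n)) (Real.log n) : ℝ) /
      (n * (Real.log n)⁻¹ ^ 2)) atTop (𝓝 0) := by
  have h := tendsto_finsetSum Finset.univ fun r _ =>
    (tendsto_criticalTime_mul_sq_div_exp (hx r) (k r)).comp tendsto_log_natCast
  rw [Finset.sum_const_zero] at h
  refine h.congr' ?_
  filter_upwards [eventually_gt_atTop 0] with n hn
  refine Finset.sum_congr rfl fun r _ => ?_
  rw [Function.comp, Real.exp_log (Nat.cast_pos.2 hn)]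
  field_simp

variable [LinearOrder κ] [LocallyFiniteOrderBot κ]

lemma tendsto_poissonPi_increment_criticalTime_pow (hk : StrictMono k) {x : κ → ℝ → ℝ}
    {y : κ → ℝ} (hx : ∀ r, Tendsto (x r) atTop (𝓝 (y r))) :
    Tendsto (fun n : ℕ =>
      (poissonPi (increment fun r => criticalTime (k r) (x r (Real.log n)) (Real.log n))).real
        {z | ∀ r, k r < ∑ u ∈ Finset.Iic r, z u} ^ n) atTop
      (𝓝 (Real.exp (-∑ r, Real.exp (-y r) / (k r)!))) := by
  refine tendsto_poissonPi_forall_lt_sum_pow (fun r => ?_) (tendsto_increment (fun r => ?_) ?_)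
  · refine ((tendsto_exp_mul_poissonMeasure_criticalTime (hx r) (k r)).comp
      tendsto_log_natCast).congr' ?_
    filter_upwards [tendsto_log_natCast.eventually (eventually_monotone_criticalTime hk hx),
      eventually_gt_atTop 0] with n hmono hn
    rw [Function.comp, Real.exp_log (Nat.cast_pos.2 hn), sum_Iic_increment hmono]
  · exact (tendsto_criticalTime (hx r) (k r)).comp tendsto_log_natCast
  · exact fun r s hrs => (tendsto_criticalTime_sub (hx r) (hx s) (hk hrs)).comp tendsto_log_natCast

variable {Ω : ℕ+ → Type*} [∀ n, MeasurableSpace (Ω n)] {μ : (n : ℕ+) → Measure (Ω n)}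
  {X : (n : ℕ+) → ℕ → Ω n → Fin (n : ℕ)}

theorem tendsto_measureReal_completedEvent (hX : ∀ n j, Measurable (X n j))
    (hindep : ∀ n, iIndepFun (X n) (μ n))
    (hunif : ∀ n j i, (μ n).real {ω | X n j ω = i} = 1 / (n : ℝ)) (hk : StrictMono k)
    (x : κ → ℝ) :
    Tendsto (fun n : ℕ+ => (μ n).real (completedEvent (X n) k fun r =>
      ⌊(n : ℕ) * criticalTime (k r) (x r) (Real.log n)⌋₊)) atTop
      (𝓝 (Real.exp (-∑ r, Real.exp (-x r) / (k r)!))) := by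
  have hlower : ∀ r, Tendsto (fun L => x r - L⁻¹) atTop (𝓝 (x r)) := fun r => by
    simpa using tendsto_inv_atTop_zero.const_sub (x r)
  have hupper : ∀ r, Tendsto (fun L => x r + L⁻¹) atTop (𝓝 (x r)) := fun r => by
    simpa using tendsto_inv_atTop_zero.const_add (x r)
  have hL : Tendsto (fun n : ℕ+ => Real.log (n : ℕ)) atTop atTop :=
    tendsto_log_natCast.comp tendsto_PNat_val_atTop_atTop
  have hlim_lower := (tendsto_poissonPi_increment_criticalTime_pow hk hlower).sub
    (tendsto_sum_criticalTime_div (k := k) hlower) |>.comp tendsto_PNat_val_atTop_atTop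
  have hlim_upper := (tendsto_poissonPi_increment_criticalTime_pow hk hupper).add
    (tendsto_sum_criticalTime_div (k := k) hupper) |>.comp tendsto_PNat_val_atTop_atTop
  rw [sub_zero] at hlim_lower
  rw [add_zero] at hlim_upper
  refine tendsto_of_tendsto_of_tendsto_of_le_of_le' hlim_lower hlim_upper ?_ ?_
  · have hshift := eventually_all.2 fun r => eventually_criticalTime_add_le (hlower r)
      (x' := fun _ => x r) (δ := fun L => L⁻¹) (fun L => by simp) (k r)
    filter_upwards [hL.eventually (eventually_monotone_criticalTime hk hlower),
      hL.eventually hshift, hL.eventually_gt_atTop 0] with n hmono hn hlog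
    simpa using poissonPi_increment_pow_sub_le (hX n) (hindep n) (by simpa using hunif n) k hmono
      (inv_pos.2 hlog) hn
  · have hshift := eventually_all.2 fun r => eventually_criticalTime_add_le
      (tendsto_const_nhds (x := x r)) (δ := fun L => L⁻¹) (fun L => le_rfl) (k r)
    filter_upwards [hL.eventually (eventually_monotone_criticalTime hk hupper),
      hL.eventually hshift, hL.eventually_gt_atTop 0] with n hmono hn hlog
    simpa using measureReal_completedEvent_le_poissonPi_increment_pow_add (hX n) (hindep n)
      (by simpa using hunif n) k hmono (inv_pos.2 hlog) hn

theorem tendsto_measureReal_normalizedTimes (hX : ∀ n j, Measurable (X n j))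
    (hindep : ∀ n, iIndepFun (X n) (μ n))
    (hunif : ∀ n j i, (μ n).real {ω | X n j ω = i} = 1 / (n : ℝ)) (S : Finset ℕ) (x : ℕ → ℝ) :
    Tendsto (fun n : ℕ+ => (μ n).real
      {ω | ∀ r ∈ S, normalizedTimes (fun j => X n j ω) r ≤ x r}) atTop
      (𝓝 (Real.exp (-∑ r ∈ S, Real.exp (-x r) / r !))) := by
  have h := tendsto_measureReal_completedEvent hX hindep hunif (k := ((↑) : S → ℕ))
    (fun _ _ h => h) fun r => x r
  rw [Finset.sum_coe_sort S fun r => Real.exp (-x r) / r !] at h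
  refine h.congr' ?_
  have hcoe := (tendsto_log_natCast.comp tendsto_PNat_val_atTop_atTop).eventually <|
    (eventually_all_finset S).2 fun r _ =>
      eventually_coe_criticalTime (tendsto_const_nhds (x := x r)) r
  filter_upwards [hcoe] with n hn
  refine measureReal_congr ?_
  filter_upwards [ae_exists_album_eq_univ (hX n) (hindep n) (hunif n)] with ω hω
  refine propext (Subtype.forall.trans (forall₂_congr fun r hr => ?_))
  rw [← album_eq_univ_iff, ← completionTime_le_iff (hω r),
    ← normalizedTimes_le_iff n.pos (hn r hr)]

end FiniteDimensional

section Gumbel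

variable {Ω' : Type*} [MeasurableSpace Ω'] {P : Measure Ω'}

lemma measureReal_le_eq_of_continuous [IsFiniteMeasure P] {Z : Ω' → ℝ} {F : ℝ → ℝ}
    (hF : Continuous F) (h : ∀ x, P.real {ω | Z ω < x} = F x) (x : ℝ) :
    P.real {ω | Z ω ≤ x} = F x := by
  refine le_antisymm ?_ ?_
  · refine ge_of_tendsto ((hF.tendsto x).mono_left (nhdsWithin_le_nhds (s := Set.Ioi x))) ?_
    filter_upwards [self_mem_nhdsWithin] with y hy
    rw [← h y]
    exact measureReal_mono fun ω (hω : Z ω ≤ x) => show Z ω < y from hω.trans_lt hy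
  · rw [← h x]
    exact measureReal_mono fun ω (hω : Z ω < x) => show Z ω ≤ x from hω.le

lemma measureReal_forall_le_gumbel {B : ℕ → Ω' → ℝ} (hB_indep : iIndepFun B P)
    (hB_gumbel : ∀ (r : ℕ) (x : ℝ),
      P.real {ω | B r ω < x} = Real.exp (-(Real.exp (-x) / (r ! : ℝ)))) (S : Finset ℕ)
    (x : ℕ → ℝ) :
    P.real {ω | ∀ r ∈ S, B r ω ≤ x r} = Real.exp (-∑ r ∈ S, Real.exp (-x r) / r !) := by
  have := hB_indep.isProbabilityMeasure
  have h := hB_indep.measure_inter_preimage_eq_mul S (sets := fun r => Set.Iic (x r))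
    fun r _ => measurableSet_Iic
  have hset : {ω | ∀ r ∈ S, B r ω ≤ x r} = ⋂ r ∈ S, B r ⁻¹' Set.Iic (x r) := by
    ext ω; simp
  rw [hset, measureReal_def, h, ENNReal.toReal_prod, ← Finset.sum_neg_distrib, Real.exp_sum]
  refine Finset.prod_congr rfl fun r _ => ?_
  exact measureReal_le_eq_of_continuous (F := fun x => Real.exp (-(Real.exp (-x) / r !)))
    (by fun_prop) (hB_gumbel r) (x r)

end Gumbel

end CouponCollector

theorem theorem3
    -- for every number `n ≥ 1` of types: independent, uniformly distributed coupons
    {Ω : ℕ+ → Type*} [∀ n, MeasurableSpace (Ω n)]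
    (μ : (n : ℕ+) → Measure (Ω n)) [∀ n, IsProbabilityMeasure (μ n)]
    (X : (n : ℕ+) → ℕ → Ω n → Fin (n : ℕ))
    (hX_meas : ∀ n k, Measurable (X n k))
    (hX_indep : ∀ n, iIndepFun (X n) (μ n))
    (hX_unif : ∀ n k i, (μ n).real {ω | X n k ω = i} = 1 / (n : ℝ))
    -- the limit: independent Gumbel variables
    {Ω' : Type*} [MeasurableSpace Ω'] (P : Measure Ω') [IsProbabilityMeasure P]
    (B : ℕ → Ω' → ℝ)
    (hB_meas : ∀ r, Measurable (B r))
    (hB_indep : iIndepFun B P)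
    (hB_gumbel : ∀ (r : ℕ) (x : ℝ),
      P.real {ω | B r ω < x} = Real.exp (-(Real.exp (-x) / (r ! : ℝ)))) :
    -- almost surely all albums are completed in finite time
    (∀ n, ∀ᵐ ω ∂(μ n), ∀ r : ℕ, ∃ k : ℕ,
      CouponCollector.album (fun j => X n j ω) k r = Set.univ) ∧
    -- convergence in distribution in the product space `ℕ → ℝ`
    TendstoInDistribution
      (fun (n : ℕ+) (ω : Ω n) => CouponCollector.normalizedTimes (fun j => X n j ω))
      atTop (fun (ω : Ω') (r : ℕ) => B r ω) μ P := by
  have hmeas := fun n => CouponCollector.measurable_normalizedTimes (hX_meas n)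
  have hlim : Measurable (fun (ω : Ω') (r : ℕ) => B r ω) := measurable_pi_lambda _ hB_meas
  refine ⟨fun n => CouponCollector.ae_exists_album_eq_univ (hX_meas n) (hX_indep n) (hX_unif n),
    ⟨fun n => (hmeas n).aemeasurable, hlim.aemeasurable, ?_⟩⟩
  refine CouponCollector.tendsto_probabilityMeasure_of_tendsto_cdf fun S b => ?_
  have hset := CouponCollector.measurableSet_forall_mem_le S b
  simp only [ProbabilityMeasure.coe_mk]
  rw [map_measureReal_apply hlim hset]
  simp_rw [map_measureReal_apply (hmeas _) hset]
  have h := CouponCollector.tendsto_measureReal_normalizedTimes hX_meas hX_indep hX_unif S b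
  rw [← CouponCollector.measureReal_forall_le_gumbel hB_indep hB_gumbel S b] at h
  exact h
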